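/- Let $(a_j)_{j\ge 0}$, $(b_j)_{j\ge 0}$ be bounded real sequences with $b_j>0$ for all $j$. Let $H_{[0,\infty)}$ be the bounded operator on $\ell^2=\ell^2(\{0,1,2,\dots\};\mathbb C)$ given by the tridiagonal matrix with diagonal $(a_0,a_1,a_2,\dots)$, superdiagonal $(-b_0,b_1,b_2,\dots)$ and subdiagonal $(b_0,b_1,b_2,\dots)$. For $n\ge 0$ let $H_{[0,n]}$ be its upper left $(n+1)\times(n+1)$ block, and let $H_{[1,\infty)}$ be the bounded operator on $\ell^2$ given by the symmetric Jacobi matrix with diagonal $(a_1,a_2,\dots)$ and off-diagonals $(b_1,b_2,\dots)$. Put $\eta=\mathrm{diag}(-1,1,1,\dots)$ on $\ell^2$ and $\eta_n=\mathrm{diag}(-1,1,\dots,1)$ on $\mathbb C^{n+1}$. An eigenvalue of nonpositive type of $H_{[0,\infty)}$ (respectively $H_{[0,n]}$) is an eigenvalue $\lambda$ with $\operatorname{Im}\lambda\ge 0$ that has an eigenvector $f\ne 0$ with $\langle f,\eta f\rangle\le 0$ (respectively $\langle f,\eta_n f\rangle\le 0$). Let $t_3<t_4$ be real numbers such that the spectrum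 of $H_{[1,\infty)}$ is contained in $[t_3,t_4]$, let $\lambda_\infty$ be an eigenvalue of nonpositive type of $H_{[0,\infty)}$ and, for each $n\ge 0$, let $\lambda_n$ be an eigenvalue of nonpositive type of $H_{[0,n]}$. Suppose that $\lambda_\infty\notin[t_3,t_4]$ and that $\lambda_\infty$ is a simple eigenvalue of $H_{[0,\infty)}$, i.e. $\dim\bigcup_{k\ge1}\ker\,(H_{[0,\infty)}-\lambda_\infty)^k=1$. Let $$g=\frac{|\lambda_\infty-t_4|+|\lambda_\infty-t_3|}{t_4-t_3},\qquad q=g+\sqrt{g^2-1},$$ so that $g$ is the reciprocal of the eccentricity of the ellipse through $\lambda_\infty$ with foci $t_3,t_4$. Then $g>1$ and $$\limsup_{n\to\infty}|\lambda_\infty-\lambda_n|^{1/n}\le\frac1{q^2}.$$ If, in addition, $\lambda_\infty\in\mathbb R$, then $\lambda_n\in\mathbb R$ for all sufficiently large $n$. -/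

import Mathlib

open Filter

/-- The Hilbert space of square-summable complex sequences indexed by `0, 1, 2, ...`. -/
abbrev EllTwo : Type := lp (fun _ : ℕ => ℂ) 2

/-- The diagonal operator `(x j) ↦ (c j * x j)` on `ℓ²` for a bounded real sequence `c`. -/
noncomputable def diagOp (c : ℕ → ℝ) (hc : ∃ C : ℝ, ∀ j, |c j| ≤ C) : EllTwo →L[ℂ] EllTwo :=
  have key : ∀ (C : ℝ), (∀ j, |c j| ≤ C) → ∀ (x : EllTwo) (j : ℕ),
      ‖(c j : ℂ) * x j‖ ≤ ‖((C : ℂ) • x) j‖ := fun C hC x j => by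
    have h : |c j| ≤ |C| := (hC j).trans (le_abs_self C)
    simp only [lp.coeFn_smul, Pi.smul_apply, smul_eq_mul, norm_mul, Complex.norm_real,
      Real.norm_eq_abs]
    exact mul_le_mul_of_nonneg_right h (norm_nonneg _)
  LinearMap.mkContinuousOfExistsBound
    { toFun := fun x => ⟨fun j => (c j : ℂ) * x j,
        hc.elim fun C hC => (lp.memℓp ((C : ℂ) • x)).mono' (key C hC x)⟩
      map_add' := fun x y => lp.ext (funext fun j => by
        change (c j : ℂ) * (x j + y j) = c j * x j + c j * y j
        ring)
      map_smul' := fun r x => lp.ext (funext fun j => by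
        change (c j : ℂ) * (r * x j) = r * (c j * x j)
        ring) }
    (hc.elim fun C hC => ⟨‖(C : ℂ)‖, fun x => by
      rw [← norm_smul]
      exact lp.norm_mono (by norm_num) (key C hC x)⟩)

theorem diagOp_apply (c : ℕ → ℝ) (hc : ∃ C : ℝ, ∀ j, |c j| ≤ C) (x : EllTwo) (j : ℕ) :
    diagOp c hc x j = (c j : ℂ) * x j := rfl

theorem memEllTwo_shift (x : EllTwo) : Memℓp (fun j => x (j + 1)) 2 := by
  refine memℓp_gen ?_
  exact (summable_nat_add_iff 1).2 ((lp.memℓp x).summable (by norm_num))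

/-- The backward shift `(x 0, x 1, x 2, ...) ↦ (x 1, x 2, ...)` on `ℓ²`. -/
noncomputable def backShift : EllTwo →L[ℂ] EllTwo :=
  LinearMap.mkContinuousOfExistsBound
    { toFun := fun x => ⟨fun j => x (j + 1), memEllTwo_shift x⟩
      map_add' := fun _ _ => rfl
      map_smul' := fun _ _ => rfl }
    ⟨1, fun x => by
      rw [one_mul]
      refine lp.norm_le_of_forall_sum_le (by norm_num) (norm_nonneg x) fun s => ?_
      have h := lp.sum_rpow_le_norm_rpow (p := 2) (by norm_num) x (s.map (addRightEmbedding 1))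
      rw [Finset.sum_map] at h
      exact h⟩

theorem backShift_apply (x : EllTwo) (j : ℕ) : backShift x j = x (j + 1) := rfl

/-- The forward shift `(x 0, x 1, ...) ↦ (0, x 0, x 1, ...)` on `ℓ²`. -/
noncomputable def forwardShift : EllTwo →L[ℂ] EllTwo := ContinuousLinearMap.adjoint backShift

theorem forwardShift_apply_zero (x : EllTwo) : forwardShift x 0 = 0 := by
  have h := ContinuousLinearMap.adjoint_inner_right backShift (lp.single 2 0 (1 : ℂ)) x
  have h0 : backShift (lp.single 2 0 (1 : ℂ)) = 0 := lp.ext (funext fun j => by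
    rw [backShift_apply, lp.single_apply_ne _ _ _ (Nat.succ_ne_zero j)]; rfl)
  rw [lp.inner_single_left, h0, inner_zero_left] at h
  simpa [forwardShift] using h

theorem forwardShift_apply_succ (x : EllTwo) (j : ℕ) : forwardShift x (j + 1) = x j := by
  have h := ContinuousLinearMap.adjoint_inner_right backShift (lp.single 2 (j + 1) (1 : ℂ)) x
  have h0 : backShift (lp.single 2 (j + 1) (1 : ℂ)) = lp.single 2 j (1 : ℂ) :=
    lp.ext (funext fun i => by
      rw [backShift_apply]
      by_cases hi : i = j
      · subst hi; rw [lp.single_apply_self, lp.single_apply_self]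
      · rw [lp.single_apply_ne _ _ _ hi, lp.single_apply_ne _ _ _ (by omega)])
  rw [lp.inner_single_left, h0, lp.inner_single_left] at h
  simpa [forwardShift] using h

/-- The bounded operator on `ℓ²` given by the tridiagonal matrix with diagonal entries
`diag j` at `(j, j)`, entries `sup j` at `(j, j + 1)` and entries `sub j` at `(j + 1, j)`. -/
noncomputable def tridiagonalOp (diag sup sub : ℕ → ℝ) (hd : ∃ C : ℝ, ∀ j, |diag j| ≤ C)
    (hp : ∃ C : ℝ, ∀ j, |sup j| ≤ C) (hb : ∃ C : ℝ, ∀ j, |sub j| ≤ C) : EllTwo →L[ℂ] EllTwo :=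
  diagOp diag hd + diagOp sup hp ∘L backShift + forwardShift ∘L diagOp sub hb

theorem tridiagonalOp_apply_zero (diag sup sub : ℕ → ℝ) (hd : ∃ C : ℝ, ∀ j, |diag j| ≤ C)
    (hp : ∃ C : ℝ, ∀ j, |sup j| ≤ C) (hb : ∃ C : ℝ, ∀ j, |sub j| ≤ C) (x : EllTwo) :
    tridiagonalOp diag sup sub hd hp hb x 0 = diag 0 * x 0 + sup 0 * x 1 := by
  change diagOp diag hd x 0 + diagOp sup hp (backShift x) 0
    + forwardShift (diagOp sub hb x) 0 = _
  rw [forwardShift_apply_zero, diagOp_apply, diagOp_apply, backShift_apply, add_zero]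

theorem tridiagonalOp_apply_succ (diag sup sub : ℕ → ℝ) (hd : ∃ C : ℝ, ∀ j, |diag j| ≤ C)
    (hp : ∃ C : ℝ, ∀ j, |sup j| ≤ C) (hb : ∃ C : ℝ, ∀ j, |sub j| ≤ C) (x : EllTwo) (j : ℕ) :
    tridiagonalOp diag sup sub hd hp hb x (j + 1) =
      sub j * x j + diag (j + 1) * x (j + 1) + sup (j + 1) * x (j + 2) := by
  change diagOp diag hd x (j + 1) + diagOp sup hp (backShift x) (j + 1)
    + forwardShift (diagOp sub hb x) (j + 1) = _
  rw [forwardShift_apply_succ, diagOp_apply, diagOp_apply, diagOp_apply, backShift_apply]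
  ring

/-- Jacobi parameters: bounded real sequences `a`, `b` with `b` strictly positive. -/
structure JacobiParameters where
  a : ℕ → ℝ
  b : ℕ → ℝ
  a_bdd : ∃ C : ℝ, ∀ j, |a j| ≤ C
  b_bdd : ∃ C : ℝ, ∀ j, |b j| ≤ C
  b_pos : ∀ j, 0 < b j

namespace JacobiParameters

variable (J : JacobiParameters)

/-- The superdiagonal `(-b 0, b 1, b 2, ...)` of the non-symmetric Jacobi matrix. -/
def signedB (j : ℕ) : ℝ := if j = 0 then -J.b 0 else J.b j

theorem signedB_bdd : ∃ C : ℝ, ∀ j, |J.signedB j| ≤ C := by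
  obtain ⟨C, hC⟩ := J.b_bdd
  refine ⟨C, fun j => ?_⟩
  unfold signedB
  split_ifs
  · rw [abs_neg]; exact hC 0
  · exact hC j

/-- The operator `H_{[0,∞)}` on `ℓ²`: diagonal `a 0, a 1, ...`, superdiagonal
`-b 0, b 1, b 2, ...`, subdiagonal `b 0, b 1, ...`. -/
noncomputable def H : EllTwo →L[ℂ] EllTwo :=
  tridiagonalOp J.a J.signedB J.b J.a_bdd J.signedB_bdd J.b_bdd

/-- The symmetric Jacobi operator `H_{[1,∞)}` on `ℓ²`: diagonal `a 1, a 2, ...`,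
off-diagonals `b 1, b 2, ...`. The basis vector `e_{j+1}` is the sequence supported at `j`. -/
noncomputable def H₁ : EllTwo →L[ℂ] EllTwo :=
  tridiagonalOp (fun j => J.a (j + 1)) (fun j => J.b (j + 1)) (fun j => J.b (j + 1))
    (J.a_bdd.imp fun _ h j => h (j + 1)) (J.b_bdd.imp fun _ h j => h (j + 1))
    (J.b_bdd.imp fun _ h j => h (j + 1))

/-- The finite truncation `H_{[0,n]}`, a matrix of size `n + 1`. -/
noncomputable def truncMatrix (n : ℕ) : Matrix (Fin (n + 1)) (Fin (n + 1)) ℂ :=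
  Matrix.of fun i j =>
    if (j : ℕ) = i then (J.a i : ℂ)
    else if (j : ℕ) = i + 1 then (J.signedB i : ℂ)
    else if (i : ℕ) = j + 1 then (J.b j : ℂ)
    else 0

/-- The truncation `H_{[0,n]}` as an operator on `ℂ^{n+1}` with its Euclidean inner product. -/
noncomputable def truncH (n : ℕ) :
    EuclideanSpace ℂ (Fin (n + 1)) →L[ℂ] EuclideanSpace ℂ (Fin (n + 1)) :=
  Matrix.toEuclideanCLM (𝕜 := ℂ) (J.truncMatrix n)

end JacobiParameters

/-- The sign sequence `(-1, 1, 1, ...)`. -/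
def etaSign (j : ℕ) : ℝ := if j = 0 then -1 else 1

theorem etaSign_bdd : ∃ C : ℝ, ∀ j, |etaSign j| ≤ C :=
  ⟨1, fun j => by unfold etaSign; split_ifs <;> simp⟩

/-- The fundamental symmetry `η = diag (-1, 1, 1, ...)` on `ℓ²`. -/
noncomputable def eta : EllTwo →L[ℂ] EllTwo := diagOp etaSign etaSign_bdd

/-- The fundamental symmetry `η_n = diag (-1, 1, ..., 1)` on `ℂ^{n+1}`. -/
noncomputable def etaFin (n : ℕ) :
    EuclideanSpace ℂ (Fin (n + 1)) →L[ℂ] EuclideanSpace ℂ (Fin (n + 1)) :=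
  Matrix.toEuclideanCLM (𝕜 := ℂ) (Matrix.diagonal fun i : Fin (n + 1) => (etaSign i : ℂ))

/-- `μ` is an eigenvalue of nonpositive type of `T`, with respect to the indefinite inner product
`⟨x, η y⟩`, normalised to lie in the closed upper half-plane: some eigenvector `f` for `μ`
satisfies `⟨f, η f⟩ ≤ 0`. (For `η` selfadjoint, `⟨f, η f⟩` is real.) -/
def IsNonposTypeEigenvalue {E : Type*} [NormedAddCommGroup E] [InnerProductSpace ℂ E]
    (η T : E →L[ℂ] E) (μ : ℂ) : Prop :=
  0 ≤ μ.im ∧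
    ∃ f : E, Module.End.HasEigenvector (T : E →ₗ[ℂ] E) μ f ∧ (inner ℂ f (η f)).re ≤ 0

/-- `μ` is an (algebraically) simple eigenvalue of `T`: its root subspace
`⋃ k, ker ((T - μ) ^ k)` is one-dimensional. -/
def IsSimpleEigenvalue {E : Type*} [NormedAddCommGroup E] [InnerProductSpace ℂ E]
    (T : E →L[ℂ] E) (μ : ℂ) : Prop :=
  Module.finrank ℂ (Module.End.maxGenEigenspace (T : E →ₗ[ℂ] E) μ) = 1

/-- The number `(|z - t₄| + |z - t₃|) / (t₄ - t₃)`, the reciprocal of the eccentricity of the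
ellipse through `z` with foci `t₃` and `t₄`. -/
noncomputable def ellipseG (t₃ t₄ : ℝ) (z : ℂ) : ℝ :=
  (‖z - (t₄ : ℂ)‖ + ‖z - (t₃ : ℂ)‖) / (t₄ - t₃)

/-- The number `q = g + √(g² - 1)`; the ellipse above has sum of semi-axes `(t₄ - t₃) q / 2`. -/
noncomputable def ellipseQ (t₃ t₄ : ℝ) (z : ℂ) : ℝ :=
  ellipseG t₃ t₄ z + Real.sqrt (ellipseG t₃ t₄ z ^ 2 - 1)

/-! Split off the first coordinate: with `A = H₁`, first basis vector `e`, `α = a 0` and `β = b 0`,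
the operator is the block matrix `(α, -β⟨e, ·⟩; β e, A)`. Nonpositive type forces a nonzero first
entry, so the eigenvector scales to `(1, u)` with `‖u‖ ≤ 1`, `(A - ζ) u = -β e` and `ζ = α - β⟨e,
u⟩`. The truncations are the Galerkin versions of this system on spaces `V n` that contain the
Krylov spaces of `e`.

Convergence comes from the sign condition: the norm bounds and the choice of the upper half-plane
give `‖ζ - z‖ ^ 3 ≤ C ‖u - y‖` for every `y ∈ V n` (`norm_sub_pow_three_le`). So `z n` eventually
stays away from `[t₃, t₄]`, where `A - z n` is uniformly coercive, and Céa's lemma gives `v n → u`.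

For the rate, let `u'` solve the dual problem `(A - conj ζ) u' = -β e`. The eigenvalue error is at
most a constant times the product of the approximation errors of `u` and `u'` from `V n`
(`eventually_norm_sub_le_mul`), and Chebyshev polynomials make each factor `O(q⁻ⁿ)`. The constant is
finite because `⟨u', u⟩ ≠ 1`; equality would produce a Jordan chain
(`inner_ne_one_of_isSimpleEigenvalue`).

For real `ζ`, `u` solves the dual problem too, so `‖u‖ ≠ 1`; a nonreal `z n` would force `‖v n‖ =
1`, which `v n → u` excludes for large `n`. -/

/-! ### Chebyshev polynomials on and off the interval. -/

open Polynomial in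
theorem norm_aeval_le_of_spectrum_subset {E : Type*} [NormedAddCommGroup E] [InnerProductSpace ℂ E]
    [CompleteSpace E] {A : E →L[ℂ] E} (hA : IsSelfAdjoint A) {s : Set ℝ}
    (hs : spectrum ℂ A ⊆ Complex.ofReal '' s) (p : ℂ[X]) {C : ℝ} (hC : 0 ≤ C)
    (hp : ∀ x ∈ s, ‖p.eval (x : ℂ)‖ ≤ C) : ‖aeval A p‖ ≤ C := by
  have : IsStarNormal A := hA.isStarNormal
  rw [← cfc_polynomial p A]
  refine norm_cfc_le hC fun z hz => ?_
  obtain ⟨x, hx, rfl⟩ := hs hz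
  exact hp x hx

/-- The map `x ↦ (2 x - t₃ - t₄) / (t₄ - t₃)` sending `[t₃, t₄]` onto `[-1, 1]`. -/
noncomputable def affineToUnit (t₃ t₄ : ℝ) (z : ℂ) : ℂ := (2 * z - t₃ - t₄) / (t₄ - t₃)

open Polynomial in
/-- The Chebyshev polynomial of the first kind transplanted to the interval `[t₃, t₄]`. -/
noncomputable def chebyshevOn (t₃ t₄ : ℝ) (n : ℕ) : ℂ[X] :=
  (Chebyshev.T ℂ n).comp (C (2 / (t₄ - t₃) : ℂ) * X + C (-(t₃ + t₄) / (t₄ - t₃) : ℂ))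

theorem eval_chebyshevOn (t₃ t₄ : ℝ) (n : ℕ) (z : ℂ) :
    (chebyshevOn t₃ t₄ n).eval z =
      (Polynomial.Chebyshev.T ℂ n).eval (affineToUnit t₃ t₄ z) := by
  simp only [chebyshevOn, affineToUnit, Polynomial.eval_comp, Polynomial.eval_add,
    Polynomial.eval_mul, Polynomial.eval_C, Polynomial.eval_X]
  congr 1
  ring

theorem natDegree_chebyshevOn_le (t₃ t₄ : ℝ) (n : ℕ) : (chebyshevOn t₃ t₄ n).natDegree ≤ n := by
  refine Polynomial.natDegree_comp_le.trans ?_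
  rw [Polynomial.Chebyshev.natDegree_T]
  simpa using Nat.mul_le_mul_left n
    (Polynomial.natDegree_linear_le (a := (2 / (t₄ - t₃) : ℂ)) (b := -(t₃ + t₄) / (t₄ - t₃)))

theorem norm_eval_chebyshevOn_le {t₃ t₄ : ℝ} (ht : t₃ < t₄) (n : ℕ) {x : ℝ}
    (hx : x ∈ Set.Icc t₃ t₄) : ‖(chebyshevOn t₃ t₄ n).eval (x : ℂ)‖ ≤ 1 := by
  have h0 : 0 < t₄ - t₃ := sub_pos.2 ht
  have h1 : affineToUnit t₃ t₄ x =
      Complex.cos (Real.arccos ((2 * x - t₃ - t₄) / (t₄ - t₃)) : ℝ) := by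
    rw [← Complex.ofReal_cos, Real.cos_arccos, affineToUnit]
    · push_cast; rfl
    · rw [le_div_iff₀ h0]; linarith [hx.1]
    · rw [div_le_iff₀ h0]; linarith [hx.2]
  rw [eval_chebyshevOn, h1, Polynomial.Chebyshev.T_complex_cos]
  have h2 : ((n : ℤ) : ℂ) * (Real.arccos ((2 * x - t₃ - t₄) / (t₄ - t₃)) : ℝ) =
    ((n * Real.arccos ((2 * x - t₃ - t₄) / (t₄ - t₃)) : ℝ) : ℂ) := by push_cast; rfl
  rw [h2, ← Complex.ofReal_cos, Complex.norm_real]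
  exact Real.abs_cos_le_one _

/-- The two roots `z ± s` of `w² - 2zw + 1` have product 1, so one of them has modulus at least 1.
-/
theorem exists_joukowski (z : ℂ) : ∃ w : ℂ, 1 ≤ ‖w‖ ∧ z = (w + w⁻¹) / 2 := by
  obtain ⟨s, hs⟩ := IsAlgClosed.exists_pow_nat_eq (z ^ 2 - 1) (n := 2) (by norm_num)
  have h1 : (z + s) * (z - s) = 1 := by linear_combination -hs
  have h2 : (z + s)⁻¹ = z - s := inv_eq_of_mul_eq_one_right h1
  have h3 : (z - s)⁻¹ = z + s := inv_eq_of_mul_eq_one_left h1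
  rcases le_total 1 ‖z + s‖ with h | h
  · exact ⟨z + s, h, by rw [h2]; ring⟩
  · refine ⟨z - s, ?_, by rw [h3]; ring⟩
    have h4 : ‖z + s‖ * ‖z - s‖ = 1 := by rw [← norm_mul, h1, norm_one]
    nlinarith [norm_nonneg (z - s)]

theorem eval_chebyshev_joukowski {w : ℂ} (hw : w ≠ 0) (n : ℕ) :
    (Polynomial.Chebyshev.T ℂ n).eval ((w + w⁻¹) / 2) = (w ^ n + (w ^ n)⁻¹) / 2 := by
  have h := Polynomial.Chebyshev.T_complex_cosh (Complex.log w) n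
  have h1 : ((n : ℤ) : ℂ) * Complex.log w = n * Complex.log w := by push_cast; rfl
  rwa [h1, Complex.cosh, Complex.cosh, Complex.exp_neg, Complex.exp_neg, Complex.exp_nat_mul,
    Complex.exp_log hw] at h

theorem ellipseG_eq_norm_affineToUnit {t₃ t₄ : ℝ} (ht : t₃ < t₄) (z : ℂ) :
    ellipseG t₃ t₄ z = (‖affineToUnit t₃ t₄ z - 1‖ + ‖affineToUnit t₃ t₄ z + 1‖) / 2 := by
  have h0 : 0 < t₄ - t₃ := sub_pos.2 ht
  have h0' : (t₄ - t₃ : ℂ) ≠ 0 := by exact_mod_cast h0.ne'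
  have hn : ‖(t₄ - t₃ : ℂ)‖ = t₄ - t₃ := by
    rw [← Complex.ofReal_sub, Complex.norm_real, Real.norm_of_nonneg h0.le]
  have h1 : affineToUnit t₃ t₄ z - 1 = 2 * (z - t₄) / (t₄ - t₃) := by
    unfold affineToUnit; field_simp; ring
  have h2 : affineToUnit t₃ t₄ z + 1 = 2 * (z - t₃) / (t₄ - t₃) := by
    unfold affineToUnit; field_simp; ring
  rw [h1, h2, norm_div, norm_div, norm_mul, norm_mul, hn, Complex.norm_ofNat, ellipseG]
  field_simp

/-- Both terms on the left are squares `(w ∓ 1)²` over `2w`, so the parallelogram law adds their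
norms. Hence circles in `w` map to ellipses with foci `±1`. -/
theorem norm_sub_one_add_norm_add_one_joukowski {w : ℂ} (hw : w ≠ 0) :
    ‖(w + w⁻¹) / 2 - 1‖ + ‖(w + w⁻¹) / 2 + 1‖ = ‖w‖ + ‖w‖⁻¹ := by
  have h1 : (w + w⁻¹) / 2 - 1 = (w - 1) ^ 2 / (2 * w) := by field_simp; ring
  have h2 : (w + w⁻¹) / 2 + 1 = (w + 1) ^ 2 / (2 * w) := by field_simp; ring
  have h3 : ‖w + 1‖ ^ 2 + ‖w - 1‖ ^ 2 = 2 * (‖w‖ ^ 2 + 1) := by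
    simpa using parallelogram_law_with_norm ℝ w 1
  have h4 : ‖w‖ ≠ 0 := norm_ne_zero_iff.2 hw
  rw [h1, h2, norm_div, norm_div, norm_pow, norm_pow, norm_mul, Complex.norm_ofNat]
  field_simp
  linarith

theorem ellipse_joukowski {t₃ t₄ : ℝ} (ht : t₃ < t₄) {z w : ℂ} (hw : 1 ≤ ‖w‖)
    (hz : affineToUnit t₃ t₄ z = (w + w⁻¹) / 2) :
    ellipseG t₃ t₄ z = (‖w‖ + ‖w‖⁻¹) / 2 ∧ ellipseQ t₃ t₄ z = ‖w‖ := by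
  have h0 : 0 < ‖w‖ := by linarith
  have hG : ellipseG t₃ t₄ z = (‖w‖ + ‖w‖⁻¹) / 2 := by
    rw [ellipseG_eq_norm_affineToUnit ht, hz,
      norm_sub_one_add_norm_add_one_joukowski (norm_pos_iff.1 h0)]
  refine ⟨hG, ?_⟩
  have h1 : ellipseG t₃ t₄ z ^ 2 - 1 = ((‖w‖ - ‖w‖⁻¹) / 2) ^ 2 := by
    rw [hG]; field_simp; ring
  have h2 : ‖w‖⁻¹ ≤ 1 := inv_le_one_of_one_le₀ hw
  rw [ellipseQ, h1, Real.sqrt_sq (by linarith), hG]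
  ring

/-- On the unit circle `(w + w⁻¹) / 2 = Re w ∈ [-1, 1]`, which would put `z` on the interval. -/
theorem one_lt_norm_joukowski {t₃ t₄ : ℝ} (ht : t₃ < t₄) {z w : ℂ}
    (hout : z ∉ Complex.ofReal '' Set.Icc t₃ t₄) (hw : 1 ≤ ‖w‖)
    (hz : affineToUnit t₃ t₄ z = (w + w⁻¹) / 2) : 1 < ‖w‖ := by
  refine lt_of_le_of_ne hw fun h => hout ?_
  have h0 : 0 < t₄ - t₃ := sub_pos.2 ht
  have h0' : (t₄ - t₃ : ℂ) ≠ 0 := by exact_mod_cast h0.ne'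
  have h1 : w⁻¹ = (starRingEnd ℂ) w := Complex.inv_eq_conj h.symm
  have h2 : affineToUnit t₃ t₄ z = (w.re : ℂ) := by
    rw [hz, h1, Complex.add_conj]; push_cast; ring
  have h3 : |w.re| ≤ 1 := h ▸ Complex.abs_re_le_norm w
  obtain ⟨h4, h5⟩ := abs_le.1 h3
  refine ⟨((t₄ - t₃) * w.re + t₃ + t₄) / 2, ⟨by nlinarith, by nlinarith⟩, ?_⟩
  push_cast
  rw [← h2, affineToUnit]
  field_simp
  ring

theorem one_lt_ellipseG {t₃ t₄ : ℝ} (ht : t₃ < t₄) {z : ℂ}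
    (hout : z ∉ Complex.ofReal '' Set.Icc t₃ t₄) : 1 < ellipseG t₃ t₄ z := by
  obtain ⟨w, hw, hz⟩ := exists_joukowski (affineToUnit t₃ t₄ z)
  have h1 := one_lt_norm_joukowski ht hout hw hz
  rw [(ellipse_joukowski ht hw hz).1]
  have h2 : 0 < ‖w‖ := by linarith
  have h3 : ‖w‖ + ‖w‖⁻¹ = 2 + (‖w‖ - 1) ^ 2 / ‖w‖ := by field_simp; ring
  have h4 : 0 < (‖w‖ - 1) ^ 2 / ‖w‖ := div_pos (pow_pos (by linarith) 2) h2
  linarith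

theorem one_lt_ellipseQ {t₃ t₄ : ℝ} (ht : t₃ < t₄) {z : ℂ}
    (hout : z ∉ Complex.ofReal '' Set.Icc t₃ t₄) : 1 < ellipseQ t₃ t₄ z :=
  (one_lt_ellipseG ht hout).trans_le (le_add_of_nonneg_right (Real.sqrt_nonneg _))

/-- Chebyshev polynomials grow like `q ^ n` away from their interval of oscillation. -/
theorem ellipseQ_pow_le_norm_eval_chebyshevOn {t₃ t₄ : ℝ} (ht : t₃ < t₄) (z : ℂ) (n : ℕ) :
    (ellipseQ t₃ t₄ z ^ n - 1) / 2 ≤ ‖(chebyshevOn t₃ t₄ n).eval z‖ := by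
  obtain ⟨w, hw, hz⟩ := exists_joukowski (affineToUnit t₃ t₄ z)
  have h0 : 0 < ‖w‖ := by linarith
  rw [(ellipse_joukowski ht hw hz).2, eval_chebyshevOn, hz,
    eval_chebyshev_joukowski (norm_pos_iff.1 h0), norm_div, Complex.norm_ofNat]
  have h1 : ‖w ^ n‖ - ‖-(w ^ n)⁻¹‖ ≤ ‖w ^ n - -(w ^ n)⁻¹‖ := norm_sub_norm_le _ _
  rw [sub_neg_eq_add, norm_neg, norm_inv, norm_pow] at h1
  have h2 : (‖w‖ ^ n)⁻¹ ≤ 1 := inv_le_one_of_one_le₀ (one_le_pow₀ hw)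
  linarith

/-- The foci are real; therefore the dual problem, posed at `conj ζ`, has the same rate. -/
theorem ellipseQ_conj (t₃ t₄ : ℝ) (z : ℂ) :
    ellipseQ t₃ t₄ ((starRingEnd ℂ) z) = ellipseQ t₃ t₄ z := by
  have h (t : ℝ) : ‖(starRingEnd ℂ) z - t‖ = ‖z - t‖ := by
    rw [← Complex.norm_conj, map_sub, Complex.conj_conj, Complex.conj_ofReal]
  simp only [ellipseQ, ellipseG, h]

/-! ### Krylov approximation, coercivity and Galerkin eigenpairs. -/

section Galerkin

variable {E : Type*} [NormedAddCommGroup E] [InnerProductSpace ℂ E]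

open scoped InnerProductSpace Topology ComplexConjugate

theorem aeval_apply_mem_of_degree_lt {A : E →L[ℂ] E} {V : ℕ → Submodule ℂ E} {e : E}
    (hmono : Monotone V) (he : e ∈ V 1) (hV : ∀ n, ∀ x ∈ V n, A x ∈ V (n + 1))
    {s : Polynomial ℂ} {n : ℕ} (hs : s.degree < n) : Polynomial.aeval A s e ∈ V n := by
  have hpow : ∀ k, (A ^ k) e ∈ V (k + 1) := by
    intro k
    induction k with
    | zero => simpa using he
    | succ k ih => rw [pow_succ']; exact hV _ _ ih
  rw [Polynomial.aeval_def, Polynomial.eval₂_eq_sum, Polynomial.sum, sum_apply]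
  refine Submodule.sum_mem _ fun i hi => ?_
  have h : i < n := by
    exact_mod_cast (Polynomial.le_degree_of_mem_supp i hi).trans_lt hs
  rw [← Algebra.smul_def]
  exact Submodule.smul_mem _ _ (hmono h (hpow i))

/-- The solution `v` of `(A - z) v = k e` is approximated from a Krylov space with relative error
`‖p(A)‖ / |p(z)|`. -/
theorem exists_krylov_approx {A : E →L[ℂ] E} {V : ℕ → Submodule ℂ E} {e : E}
    (hmono : Monotone V) (he : e ∈ V 1) (hV : ∀ n, ∀ x ∈ V n, A x ∈ V (n + 1))
    {p : Polynomial ℂ} {n : ℕ} (hp : p.natDegree ≤ n) (hpA : ‖Polynomial.aeval A p‖ ≤ 1)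
    {z k : ℂ} {v : E} (hv : A v - z • v = k • e) :
    ∃ y ∈ V n, ‖p.eval z‖ * ‖v - y‖ ≤ ‖v‖ := by
  rcases eq_or_ne (p.eval z) 0 with hz | hz
  · exact ⟨0, Submodule.zero_mem _, by simp [hz]⟩
  -- Dividing `p - p(z)` by `X - z` turns `(p(A) - p(z)) v` into `k s(A) e`. The degree drops by
  -- one, which matches `e ∈ V 1` and lands in `V n`.
  obtain ⟨s, hs⟩ := Polynomial.X_sub_C_dvd_sub_C_eval (a := z) (p := p)
  have hsdeg : s.degree < n := by
    rcases eq_or_ne s 0 with rfl | h0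
    · simp
    · have h1 : (p - Polynomial.C (p.eval z)).natDegree = s.natDegree + 1 := by
        rw [hs, Polynomial.natDegree_mul (Polynomial.X_sub_C_ne_zero z) h0,
          Polynomial.natDegree_X_sub_C, add_comm]
      rw [Polynomial.natDegree_sub_C] at h1
      exact (Polynomial.natDegree_lt_iff_degree_lt h0).1 (by omega)
  have h1 : Polynomial.aeval A p v - p.eval z • v = k • Polynomial.aeval A s e := by
    have h2 := congrArg (fun q => Polynomial.aeval A q v) hs
    simp only [map_sub, mul_comm _ s, map_mul, Polynomial.aeval_X, Polynomial.aeval_C] at h2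
    rw [← map_smul, ← hv]
    simpa [Algebra.algebraMap_eq_smul_one] using h2
  refine ⟨-((p.eval z)⁻¹ * k) • Polynomial.aeval A s e,
    Submodule.smul_mem _ _ (aeval_apply_mem_of_degree_lt hmono he hV hsdeg), ?_⟩
  have h3 : v - -((p.eval z)⁻¹ * k) • Polynomial.aeval A s e =
      (p.eval z)⁻¹ • Polynomial.aeval A p v := by
    rw [neg_smul, mul_smul, ← h1, smul_sub, smul_smul, inv_mul_cancel₀ hz, one_smul]
    abel
  rw [h3, norm_smul, norm_inv, mul_inv_cancel_left₀ (norm_ne_zero_iff.2 hz)]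
  exact (ContinuousLinearMap.le_of_opNorm_le _ hpA v).trans_eq (one_mul _)

/-- `⟨w, (A - z) w⟩ = (ρ - z)‖w‖²` with `ρ` the Rayleigh quotient. The bound `‖A - c‖ ≤ (t₄ - t₃) /
2` at the midpoint `c` places `ρ` in `[t₃, t₄]`. -/
theorem coercive_of_spectrum_subset [CompleteSpace E] {A : E →L[ℂ] E} (hA : IsSelfAdjoint A)
    {t₃ t₄ : ℝ} (ht : t₃ < t₄) (hs : spectrum ℂ A ⊆ Complex.ofReal '' Set.Icc t₃ t₄) {z : ℂ}
    {δ : ℝ} (hδ : ∀ x ∈ Set.Icc t₃ t₄, δ ≤ ‖(x : ℂ) - z‖) (w : E) :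
    δ * ‖w‖ ^ 2 ≤ ‖⟪w, A w - z • w⟫_ℂ‖ := by
  rcases eq_or_ne w 0 with rfl | hw
  · simp
  have hw0 : 0 < ‖w‖ := norm_pos_iff.2 hw
  have hsym := ContinuousLinearMap.isSelfAdjoint_iff_isSymmetric.1 hA
  obtain ⟨ρ, hρ⟩ : ∃ ρ : ℝ, ⟪w, A w⟫_ℂ = ρ * (‖w‖ ^ 2 : ℝ) := by
    have h1 : conj ⟪w, A w⟫_ℂ = ⟪w, A w⟫_ℂ := by
      rw [inner_conj_symm]; exact hsym w w
    refine ⟨(⟪w, A w⟫_ℂ).re / ‖w‖ ^ 2, ?_⟩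
    rw [← Complex.ofReal_mul, div_mul_cancel₀ _ (by positivity)]
    exact (Complex.conj_eq_iff_re.1 h1).symm
  set c : ℝ := (t₃ + t₄) / 2
  have hnorm : ‖Polynomial.aeval A (Polynomial.X - Polynomial.C (c : ℂ))‖ ≤ (t₄ - t₃) / 2 := by
    refine norm_aeval_le_of_spectrum_subset hA hs _ (by linarith) fun x hx => ?_
    rw [Polynomial.eval_sub, Polynomial.eval_X, Polynomial.eval_C, ← Complex.ofReal_sub,
      Complex.norm_real, Real.norm_eq_abs, abs_le]
    constructor <;> simp only [c] <;> linarith [hx.1, hx.2]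
  have hAc : ‖⟪w, A w - (c : ℂ) • w⟫_ℂ‖ ≤ (t₄ - t₃) / 2 * ‖w‖ ^ 2 := by
    have h2 := ContinuousLinearMap.le_of_opNorm_le _ hnorm w
    simp only [map_sub, Polynomial.aeval_X, Polynomial.aeval_C, sub_apply,
      Algebra.algebraMap_eq_smul_one, smul_apply,
      one_apply_eq_self] at h2
    have h3 := norm_inner_le_norm (𝕜 := ℂ) w (A w - (c : ℂ) • w)
    nlinarith
  have hsq : ⟪w, w⟫_ℂ = ((‖w‖ ^ 2 : ℝ) : ℂ) := by
    rw [inner_self_eq_norm_sq_to_K]; push_cast; rfl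
  rw [inner_sub_right, inner_smul_right, hρ, hsq, ← sub_mul, norm_mul, Complex.norm_real,
    Real.norm_of_nonneg (by positivity), ← Complex.ofReal_sub, Complex.norm_real,
    Real.norm_eq_abs] at hAc
  have hρ' := abs_le.1 (le_of_mul_le_mul_right hAc (by positivity))
  rw [inner_sub_right, inner_smul_right, hρ, hsq, ← sub_mul, norm_mul, Complex.norm_real,
    Real.norm_of_nonneg (by positivity)]
  exact mul_le_mul_of_nonneg_right
    (hδ ρ ⟨by simp only [c] at hρ'; linarith [hρ'.1], by simp only [c] at hρ'; linarith [hρ'.2]⟩)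
    (by positivity)

/-- `v` is the tail of an eigenvector `(1, v)`, of nonpositive type, for the eigenvalue `z` of the
compression to `ℂ ⊕ V` of the operator matrix `(α, -β ⟨e, ·⟩; β e, A)`. -/
structure IsGalerkinEigenpair (A : E →L[ℂ] E) (e : E) (α β : ℝ) (V : Submodule ℂ E) (z : ℂ)
    (v : E) : Prop where
  mem : v ∈ V
  galerkin : ∀ w ∈ V, ⟪w, A v - z • v⟫_ℂ = -β * ⟪w, e⟫_ℂ
  root : β * ⟪e, v⟫_ℂ = α - z
  norm_le : ‖v‖ ≤ 1
  im_nonneg : 0 ≤ z.im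

namespace IsGalerkinEigenpair

variable {A : E →L[ℂ] E} {e : E} {α β : ℝ} {V : Submodule ℂ E} {z : ℂ} {v : E}

theorem resolvent_eq (h : IsGalerkinEigenpair A e α β ⊤ z v) : A v - z • v = (-β : ℂ) • e :=
  ext_inner_left ℂ fun w => by rw [h.galerkin w trivial, inner_smul_right]

theorem norm_le_abs_add (h : IsGalerkinEigenpair A e α β V z v) (he : ‖e‖ = 1) :
    ‖z‖ ≤ |α| + |β| := by
  have h1 : z = α - β * ⟪e, v⟫_ℂ := by rw [h.root]; ring
  rw [h1]
  refine (norm_sub_le _ _).trans ?_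
  rw [norm_mul, Complex.norm_real, Complex.norm_real, Real.norm_eq_abs, Real.norm_eq_abs]
  have h2 := norm_inner_le_norm (𝕜 := ℂ) e v
  rw [he, one_mul] at h2
  nlinarith [abs_nonneg β, h.norm_le]

/-- Testing the Galerkin equation with `v` and comparing imaginary parts with `root` gives `Im z
(‖v‖² - 1) = 0`: eigenvectors at nonreal eigenvalues are neutral. -/
theorem norm_eq_one_of_im_ne_zero [CompleteSpace E] (hA : IsSelfAdjoint A)
    (h : IsGalerkinEigenpair A e α β V z v) (hz : z.im ≠ 0) : ‖v‖ = 1 := by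
  have hsym := ContinuousLinearMap.isSelfAdjoint_iff_isSymmetric.1 hA
  have h1 : (⟪v, A v⟫_ℂ).im = 0 := by
    rw [← Complex.conj_eq_iff_im, inner_conj_symm]; exact hsym v v
  have h2 := congrArg Complex.im (h.galerkin v h.mem)
  have h3 := congrArg Complex.im h.root
  have h4 : (⟪v, e⟫_ℂ).im = -(⟪e, v⟫_ℂ).im := by
    rw [← inner_conj_symm v e, Complex.conj_im]
  rw [inner_sub_right, inner_smul_right, inner_self_eq_norm_sq_to_K] at h2
  have h5 : (z * (‖v‖ : ℂ) ^ 2).im = z.im * ‖v‖ ^ 2 := by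
    rw [← Complex.ofReal_pow, Complex.im_mul_ofReal]
  rw [← Complex.ofReal_neg, Complex.im_ofReal_mul, h4, Complex.sub_im, h1] at h2
  change 0 - (z * (‖v‖ : ℂ) ^ 2).im = _ at h2
  rw [h5] at h2
  rw [Complex.im_ofReal_mul, Complex.sub_im, Complex.ofReal_im] at h3
  have h6 : z.im * (‖v‖ ^ 2 - 1) = 0 := by linarith
  have h7 : ‖v‖ ^ 2 = 1 := by
    rcases mul_eq_zero.1 h6 with h | h
    · exact absurd h hz
    · linarith
  exact (pow_eq_one_iff_of_nonneg (norm_nonneg v) two_ne_zero).1 h7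

end IsGalerkinEigenpair

end Galerkin

/-! ### Convergence of Galerkin eigenpairs and the error product bound. -/

section GalerkinConvergence

variable {E : Type*} [NormedAddCommGroup E] [InnerProductSpace ℂ E]

open scoped InnerProductSpace Topology ComplexConjugate

theorem norm_sub_le_norm_sub_conj {z w : ℂ} (hz : 0 ≤ z.im) (hw : 0 ≤ w.im) :
    ‖z - w‖ ≤ ‖z - conj w‖ := by
  rw [← sq_le_sq₀ (norm_nonneg _) (norm_nonneg _), Complex.sq_norm, Complex.sq_norm,
    Complex.normSq_apply, Complex.normSq_apply]
  simp only [Complex.sub_re, Complex.sub_im, Complex.conj_re, Complex.conj_im]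
  nlinarith [mul_nonneg hz hw]

theorem tendsto_zero_of_pow_tendsto_zero {f : ℕ → ℝ} (k : ℕ)
    (h : Tendsto (fun n => f n ^ k) atTop (𝓝 0)) (hf : ∀ n, 0 ≤ f n) :
    Tendsto f atTop (𝓝 0) := by
  refine tendsto_order.2 ⟨fun a ha => Eventually.of_forall fun n => ha.trans_le (hf n),
    fun a ha => ?_⟩
  filter_upwards [h.eventually (gt_mem_nhds (pow_pos ha k))] with n hn
  exact lt_of_pow_lt_pow_left₀ k ha.le hn

namespace IsGalerkinEigenpair

variable {A : E →L[ℂ] E} {e : E} {α β : ℝ}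

/-- An a priori bound that needs no coercivity at `z`, hence is available before `z` is known to
avoid the spectrum. Pairing the two eigenvectors in the indefinite product shows that `(ζ - conj
z)(⟨v, u⟩ - 1)` is small. Since `‖u‖, ‖v‖ ≤ 1`, `|⟨v, u⟩ - 1|` controls `‖v - u‖²`, and `‖v - u‖`
controls `|ζ - z|`. -/
theorem norm_sub_pow_three_le (hA : A.IsSymmetric) (he : ‖e‖ = 1) {V : Submodule ℂ E} {z ζ : ℂ}
    {v u y : E} (h : IsGalerkinEigenpair A e α β V z v) (hu : IsGalerkinEigenpair A e α β ⊤ ζ u)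
    (hy : y ∈ V) :
    ‖ζ - z‖ ^ 3 ≤ 2 * β ^ 2 * ((‖A‖ + ‖z‖ + |β|) * ‖u - y‖) := by
  have h1 : ⟪A v - z • v, y⟫_ℂ = -β * ⟪e, y⟫_ℂ := by
    rw [← inner_conj_symm, h.galerkin y hy, map_mul, inner_conj_symm, map_neg, Complex.conj_ofReal]
  have h2 : ⟪A v, u⟫_ℂ = ζ * ⟪v, u⟫_ℂ - (α - conj z) := by
    have h3 : ⟪v, A u - ζ • u⟫_ℂ = -β * ⟪v, e⟫_ℂ := hu.galerkin v trivial
    have h4 := congrArg conj h.root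
    rw [map_mul, inner_conj_symm, map_sub, Complex.conj_ofReal, Complex.conj_ofReal] at h4
    rw [inner_sub_right, inner_smul_right] at h3
    have h5 : ⟪A v, u⟫_ℂ = ⟪v, A u⟫_ℂ := hA v u
    linear_combination h5 + h3 - h4
  have h3 : (ζ - conj z) * (⟪v, u⟫_ℂ - 1) =
      ⟪A v - z • v, u - y⟫_ℂ + β * ⟪e, u - y⟫_ℂ := by
    have h4 := hu.root
    rw [inner_sub_right, inner_sub_right, h1, inner_sub_left, inner_smul_left, h2]
    linear_combination -h4
  have h4 : ‖ζ - conj z‖ * ‖⟪v, u⟫_ℂ - 1‖ ≤ (‖A‖ + ‖z‖ + |β|) * ‖u - y‖ := by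
    rw [← norm_mul, h3]
    refine (norm_add_le _ _).trans ?_
    rw [norm_mul, Complex.norm_real, Real.norm_eq_abs, add_mul]
    have h5 : ‖A v - z • v‖ ≤ ‖A‖ + ‖z‖ := by
      refine (norm_sub_le _ _).trans ?_
      rw [norm_smul]
      exact add_le_add (A.unit_le_opNorm v h.norm_le)
        (mul_le_of_le_one_right (norm_nonneg _) h.norm_le)
    refine add_le_add ((norm_inner_le_norm _ _).trans ?_) ?_
    · gcongr
    · gcongr
      simpa only [he, one_mul] using norm_inner_le_norm (𝕜 := ℂ) e (u - y)
  have h5 : ‖v - u‖ ^ 2 ≤ 2 * ‖⟪v, u⟫_ℂ - 1‖ := by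
    have h6 := norm_sub_sq (𝕜 := ℂ) v u
    have h7 := Complex.abs_re_le_norm (⟪v, u⟫_ℂ - 1)
    have h8 : ‖v‖ ^ 2 ≤ 1 := pow_le_one₀ (norm_nonneg _) h.norm_le
    have h9 : ‖u‖ ^ 2 ≤ 1 := pow_le_one₀ (norm_nonneg _) hu.norm_le
    have h10 := (abs_le.1 h7).1
    rw [Complex.sub_re, Complex.one_re] at h10
    change _ = _ - 2 * (⟪v, u⟫_ℂ).re + _ at h6
    linarith
  have h6 : ‖ζ - z‖ ≤ |β| * ‖v - u‖ := by
    have h7 : ζ - z = β * ⟪e, v - u⟫_ℂ := by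
      rw [inner_sub_right, mul_sub, h.root, hu.root]; ring
    rw [h7, norm_mul, Complex.norm_real, Real.norm_eq_abs]
    gcongr
    simpa only [he, one_mul] using norm_inner_le_norm (𝕜 := ℂ) e (v - u)
  have h7 := norm_sub_le_norm_sub_conj hu.im_nonneg h.im_nonneg
  calc ‖ζ - z‖ ^ 3 = ‖ζ - z‖ ^ 2 * ‖ζ - z‖ := by ring
    _ ≤ (|β| * ‖v - u‖) ^ 2 * ‖ζ - conj z‖ := by gcongr
    _ = β ^ 2 * (‖v - u‖ ^ 2 * ‖ζ - conj z‖) := by rw [mul_pow, sq_abs]; ring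
    _ ≤ β ^ 2 * ((2 * ‖⟪v, u⟫_ℂ - 1‖) * ‖ζ - conj z‖) := by gcongr
    _ = 2 * β ^ 2 * (‖ζ - conj z‖ * ‖⟪v, u⟫_ℂ - 1‖) := by ring
    _ ≤ _ := by gcongr

/-- Galerkin quasi-optimality (Céa's lemma). -/
theorem norm_sub_le_of_coercive {V : Submodule ℂ E} {z ζ : ℂ}
    {v u y : E} (h : IsGalerkinEigenpair A e α β V z v) (hu : IsGalerkinEigenpair A e α β ⊤ ζ u)
    (hy : y ∈ V) {δ : ℝ} (hδ : ∀ w, δ * ‖w‖ ^ 2 ≤ ‖⟪w, A w - z • w⟫_ℂ‖) :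
    δ * ‖v - y‖ ≤ (‖A‖ + ‖z‖) * ‖u - y‖ + ‖ζ - z‖ * ‖u‖ := by
  rcases eq_or_ne (v - y) 0 with h0 | h0
  · rw [h0, norm_zero, mul_zero]; positivity
  have hx : 0 < ‖v - y‖ := norm_pos_iff.2 h0
  have h1 : ⟪v - y, A (v - y) - z • (v - y)⟫_ℂ =
      ⟪v - y, A (u - y) - z • (u - y) - (ζ - z) • u⟫_ℂ := by
    have h2 : A (v - y) - z • (v - y) = (A v - z • v) - (A y - z • y) := by
      rw [map_sub, smul_sub]; abel
    have h3 : A (u - y) - z • (u - y) - (ζ - z) • u = (A u - ζ • u) - (A y - z • y) := by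
      rw [map_sub, smul_sub, sub_smul]; abel
    rw [h2, h3, inner_sub_right _ (A v - z • v), inner_sub_right _ (A u - ζ • u),
      h.galerkin _ (V.sub_mem h.mem hy), hu.galerkin _ trivial]
  have h2 := hδ (v - y)
  rw [h1] at h2
  have h3 : ‖A (u - y) - z • (u - y) - (ζ - z) • u‖ ≤
      (‖A‖ + ‖z‖) * ‖u - y‖ + ‖ζ - z‖ * ‖u‖ := by
    refine (norm_sub_le _ _).trans ?_
    rw [norm_smul (ζ - z), add_mul]
    gcongr
    refine (norm_sub_le _ _).trans ?_
    rw [norm_smul]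
    gcongr
    exact A.le_opNorm _
  have h4 := h2.trans ((norm_inner_le_norm _ _).trans
    (mul_le_mul_of_nonneg_left h3 (norm_nonneg _)))
  nlinarith

/-- Eigenvalue error identity, with `u'` the solution of the dual problem. -/
theorem sub_mul_eq_inner (hA : A.IsSymmetric) {V : Submodule ℂ E} {z ζ : ℂ} {v u u' w : E}
    (h : IsGalerkinEigenpair A e α β V z v) (hu : IsGalerkinEigenpair A e α β ⊤ ζ u)
    (hu' : A u' - conj ζ • u' = (-β : ℂ) • e) (hw : w ∈ V) :
    (z - ζ) * (1 - ⟪u', v⟫_ℂ + ⟪u' - w, u⟫_ℂ) = ⟪u' - w, A (v - u) - z • (v - u)⟫_ℂ := by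
  -- Weak form of the dual equation; conjugate-linearity in the first slot turns `conj ζ` into `ζ`.
  have key : ∀ x, ⟪u', A x⟫_ℂ = ζ * ⟪u', x⟫_ℂ - β * ⟪e, x⟫_ℂ := fun x => by
    have h1 : ⟪A u', x⟫_ℂ = ⟪u', A x⟫_ℂ := hA u' x
    have h2 : A u' = conj ζ • u' + (-β : ℂ) • e := by rw [← hu']; abel
    rw [← h1, h2, inner_add_left, inner_smul_left, inner_smul_left, Complex.conj_conj,
      map_neg, Complex.conj_ofReal]
    ring
  have h1 : A (v - u) - z • (v - u) = (A v - z • v) - (A u - ζ • u) - (ζ - z) • u := by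
    rw [map_sub, smul_sub, sub_smul]; abel
  have h2 : ⟪u' - w, A (v - u) - z • (v - u)⟫_ℂ =
      ⟪u', A v - z • v⟫_ℂ - ⟪u', A u - ζ • u⟫_ℂ - (ζ - z) * ⟪u' - w, u⟫_ℂ := by
    rw [h1, inner_sub_right, inner_smul_right, inner_sub_left, inner_sub_right, inner_sub_right w,
      h.galerkin w hw, hu.galerkin w trivial]
    ring
  rw [h2, inner_sub_right, inner_sub_right, key, key, inner_smul_right, inner_smul_right]
  linear_combination h.root - hu.root

section Sequences

variable {V : ℕ → Submodule ℂ E} {z : ℕ → ℂ} {v : ℕ → E} {ζ : ℂ} {u : E} {y : ℕ → E}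

theorem tendsto_eigenvalue (hA : A.IsSymmetric) (he : ‖e‖ = 1)
    (h : ∀ n, IsGalerkinEigenpair A e α β (V n) (z n) (v n))
    (hu : IsGalerkinEigenpair A e α β ⊤ ζ u) (hyV : ∀ n, y n ∈ V n)
    (hy : Tendsto y atTop (𝓝 u)) : Tendsto z atTop (𝓝 ζ) := by
  have h1 : Tendsto (fun n => ‖u - y n‖) atTop (𝓝 0) := by
    simpa using (tendsto_const_nhds (x := u)).sub hy |>.norm
  have h2 : Tendsto (fun n => ‖ζ - z n‖ ^ 3) atTop (𝓝 0) := by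
    refine squeeze_zero (fun n => by positivity)
      (g := fun n => 2 * β ^ 2 * ((‖A‖ + (|α| + |β|) + |β|) * ‖u - y n‖)) (fun n => ?_) ?_
    · refine ((h n).norm_sub_pow_three_le hA he hu (hyV n)).trans ?_
      gcongr
      exact (h n).norm_le_abs_add he
    · simpa using (h1.const_mul (‖A‖ + (|α| + |β|) + |β|)).const_mul (2 * β ^ 2)
  have h3 := tendsto_zero_of_pow_tendsto_zero 3 h2 fun n => norm_nonneg _
  refine tendsto_iff_norm_sub_tendsto_zero.2 (h3.congr fun n => norm_sub_rev _ _)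

theorem tendsto_eigenvector (he : ‖e‖ = 1)
    (h : ∀ n, IsGalerkinEigenpair A e α β (V n) (z n) (v n))
    (hu : IsGalerkinEigenpair A e α β ⊤ ζ u) (hyV : ∀ n, y n ∈ V n)
    (hy : Tendsto y atTop (𝓝 u)) (hz : Tendsto z atTop (𝓝 ζ)) {δ : ℝ} (hδ0 : 0 < δ)
    (hδ : ∀ᶠ n in atTop, ∀ w, δ * ‖w‖ ^ 2 ≤ ‖⟪w, A w - z n • w⟫_ℂ‖) :
    Tendsto v atTop (𝓝 u) := by
  have h1 : Tendsto (fun n => ‖u - y n‖) atTop (𝓝 0) := by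
    simpa using (tendsto_const_nhds (x := u)).sub hy |>.norm
  have h2 : Tendsto (fun n => ‖ζ - z n‖) atTop (𝓝 0) := by
    simpa using (tendsto_const_nhds (x := ζ)).sub hz |>.norm
  have h3 : Tendsto (fun n => v n - y n) atTop (𝓝 0) := by
    refine squeeze_zero_norm'
      (a := fun n => ((‖A‖ + (|α| + |β|)) * ‖u - y n‖ + ‖ζ - z n‖ * ‖u‖) / δ) ?_ ?_
    · filter_upwards [hδ] with n hn
      rw [le_div_iff₀ hδ0, mul_comm]
      refine ((h n).norm_sub_le_of_coercive hu (hyV n) hn).trans ?_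
      gcongr
      exact (h n).norm_le_abs_add he
    · simpa using ((h1.const_mul (‖A‖ + (|α| + |β|))).add (h2.mul_const ‖u‖)).div_const δ
  simpa using h3.add hy

/-- The eigenvalue error is bounded by the product of the primal and the dual approximation
errors. -/
theorem eventually_norm_sub_le_mul (hA : A.IsSymmetric) (he : ‖e‖ = 1)
    (h : ∀ n, IsGalerkinEigenpair A e α β (V n) (z n) (v n))
    (hu : IsGalerkinEigenpair A e α β ⊤ ζ u) (hyV : ∀ n, y n ∈ V n)
    (hy : Tendsto y atTop (𝓝 u)) {δ : ℝ} (hδ0 : 0 < δ)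
    (hδ : ∀ᶠ n in atTop, ∀ w, δ * ‖w‖ ^ 2 ≤ ‖⟪w, A w - z n • w⟫_ℂ‖)
    {u' : E} (hu' : A u' - conj ζ • u' = (-β : ℂ) • e) (hne : ⟪u', u⟫_ℂ ≠ 1)
    {w : ℕ → E} (hwV : ∀ n, w n ∈ V n) (hw : Tendsto w atTop (𝓝 u')) :
    ∃ K, 0 ≤ K ∧ ∀ᶠ n in atTop, ‖ζ - z n‖ ≤ K * (‖u' - w n‖ * ‖u - y n‖) := by
  have hz := tendsto_eigenvalue hA he h hu hyV hy
  have hv := tendsto_eigenvector he h hu hyV hy hz hδ0 hδ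
  set M := ‖A‖ + (|α| + |β|)
  have hM : 0 ≤ M := by positivity
  set κ := ‖1 - ⟪u', u⟫_ℂ‖
  have hκ : 0 < κ := norm_pos_iff.2 (sub_ne_zero.2 hne.symm)
  have hw0 : Tendsto (fun n => u' - w n) atTop (𝓝 0) := by
    simpa using (tendsto_const_nhds (x := u')).sub hw
  -- The subtracted term is the multiple of `‖ζ - z n‖` that Céa's lemma leaves on the right of the
  -- error identity. It tends to 0, so it is absorbed on the left, where at least `κ / 2` remains.
  have h1 : Tendsto (fun n => ‖1 - ⟪u', v n⟫_ℂ + ⟪u' - w n, u⟫_ℂ‖ -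
      ‖u' - w n‖ * (M * ‖u‖ / δ)) atTop (𝓝 κ) := by
    have h2 : Tendsto (fun n => ⟪u', v n⟫_ℂ) atTop (𝓝 ⟪u', u⟫_ℂ) :=
      tendsto_const_nhds.inner hv
    have h3 : Tendsto (fun n => ⟪u' - w n, u⟫_ℂ) atTop (𝓝 ⟪(0 : E), u⟫_ℂ) :=
      hw0.inner tendsto_const_nhds
    have h4 := (((tendsto_const_nhds (x := (1 : ℂ))).sub h2).add h3).norm.sub
      (hw0.norm.mul_const (M * ‖u‖ / δ))
    simpa [κ] using h4
  refine ⟨M * (M / δ + 1) / (κ / 2), by positivity, ?_⟩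
  filter_upwards [hδ, h1.eventually (lt_mem_nhds (half_lt_self hκ))] with n hn hκn
  have hzM : ‖A‖ + ‖z n‖ ≤ M := add_le_add_right ((h n).norm_le_abs_add he) _
  have h2 : ‖v n - u‖ ≤ (M / δ + 1) * ‖u - y n‖ + ‖ζ - z n‖ * ‖u‖ / δ := by
    have h3 := (h n).norm_sub_le_of_coercive hu (hyV n) hn
    have h4 : ‖v n - y n‖ ≤ (M * ‖u - y n‖ + ‖ζ - z n‖ * ‖u‖) / δ := by
      rw [le_div_iff₀ hδ0, mul_comm]
      exact h3.trans (by gcongr)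
    have h5 : ‖v n - u‖ ≤ ‖v n - y n‖ + ‖u - y n‖ := by
      rw [norm_sub_rev u]; exact norm_sub_le_norm_sub_add_norm_sub _ _ _
    refine (h5.trans (add_le_add_left h4 _)).trans_eq (by ring)
  have h3 : ‖ζ - z n‖ * ‖1 - ⟪u', v n⟫_ℂ + ⟪u' - w n, u⟫_ℂ‖ ≤
      ‖u' - w n‖ * (M * ‖v n - u‖) := by
    rw [norm_sub_rev, ← norm_mul, (h n).sub_mul_eq_inner hA hu hu' (hwV n)]
    refine (norm_inner_le_norm _ _).trans ?_
    gcongr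
    refine (norm_sub_le _ _).trans ?_
    rw [norm_smul]
    refine le_trans ?_ (mul_le_mul_of_nonneg_right hzM (norm_nonneg _))
    rw [add_mul]
    gcongr
    exact A.le_opNorm _
  have h4 : ‖u' - w n‖ * (M * ‖v n - u‖) ≤
      M * (M / δ + 1) * (‖u' - w n‖ * ‖u - y n‖) +
        ‖ζ - z n‖ * (‖u' - w n‖ * (M * ‖u‖ / δ)) := by
    calc _ ≤ ‖u' - w n‖ * (M * ((M / δ + 1) * ‖u - y n‖ + ‖ζ - z n‖ * ‖u‖ / δ)) := by gcongr
      _ = _ := by ring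
  rw [div_mul_eq_mul_div, le_div_iff₀ (by positivity)]
  have h5 := mul_le_mul_of_nonneg_left hκn.le (norm_nonneg (ζ - z n))
  rw [mul_sub] at h5
  linarith

end Sequences

end IsGalerkinEigenpair

theorem limsup_rpow_le_of_mul_pow_le {a : ℕ → ℝ} (ha : ∀ n, 0 ≤ a n) {q C : ℝ} (hq : 1 < q)
    (h : ∀ᶠ n in atTop, a n * ((q ^ n - 1) / 2) ^ 2 ≤ C) :
    limsup (fun n : ℕ => ((a n ^ (1 / (n : ℝ)) : ℝ) : EReal)) atTop
      ≤ ((1 / q ^ 2 : ℝ) : EReal) := by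
  have hq0 : 0 < q := by linarith
  -- Once `q ^ n ≥ 2`, `(q ^ n - 1) / 2 ≥ q ^ n / 4`, and squaring gives 16. The maximum with 1
  -- keeps `D > 0`, so that `D ^ (1 / n) → 1`.
  set D : ℝ := 16 * max C 1
  have hD : 0 < D := by positivity
  have h1 : Tendsto (fun n : ℕ => D ^ (1 / (n : ℝ)) * (1 / q ^ 2)) atTop (𝓝 (1 / q ^ 2)) := by
    have h2 : Tendsto (fun n : ℕ => D ^ (1 / (n : ℝ))) atTop (𝓝 (D ^ (0 : ℝ))) :=
      (Real.continuousAt_const_rpow hD.ne').tendsto.comp tendsto_one_div_atTop_nhds_zero_nat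
    simpa only [Real.rpow_zero, one_mul] using h2.mul_const (1 / q ^ 2)
  rw [← ((continuous_coe_real_ereal.tendsto _).comp h1).limsup_eq]
  refine limsup_le_limsup ?_
  filter_upwards [h, (tendsto_pow_atTop_atTop_of_one_lt hq).eventually_ge_atTop 2,
    eventually_gt_atTop 0] with n hn hqn hn0
  refine EReal.coe_le_coe_iff.2 ?_
  have hp : 0 < q ^ n := by positivity
  have h2 : a n ≤ D * (1 / q ^ 2) ^ n := by
    have h3 : a n * (q ^ n / 4) ^ 2 ≤ max C 1 := by
      refine le_trans ?_ (hn.trans (le_max_left _ _))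
      have := ha n
      refine mul_le_mul_of_nonneg_left (pow_le_pow_left₀ (by positivity) ?_ 2) this
      linarith
    rw [div_pow, one_pow, ← pow_mul, mul_comm 2 n, pow_mul, mul_one_div, le_div_iff₀ (by positivity)]
    simp only [D]
    linarith
  refine (Real.rpow_le_rpow (ha n) h2 (by positivity)).trans_eq ?_
  rw [Real.mul_rpow hD.le (by positivity), one_div (n : ℝ),
    Real.pow_rpow_inv_natCast (by positivity) hn0.ne', ← one_div (n : ℝ)]

end GalerkinConvergence

/-! ### The rate `q⁻²` and eventual reality in the abstract setting. -/

section GalerkinRate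

variable {E : Type*} [NormedAddCommGroup E] [InnerProductSpace ℂ E]

open scoped InnerProductSpace Topology ComplexConjugate

theorem exists_pos_forall_le_norm_sub {t₃ t₄ : ℝ} {ζ : ℂ}
    (hout : ζ ∉ Complex.ofReal '' Set.Icc t₃ t₄) :
    ∃ δ > 0, ∀ z, ‖z - ζ‖ < δ → ∀ x ∈ Set.Icc t₃ t₄, δ ≤ ‖(x : ℂ) - z‖ := by
  have hK : IsClosed (Complex.ofReal '' Set.Icc t₃ t₄) :=
    (isCompact_Icc.image Complex.continuous_ofReal).isClosed
  obtain ⟨ε, hε, hball⟩ := Metric.isOpen_iff.1 hK.isOpen_compl ζ hout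
  refine ⟨ε / 2, by positivity, fun z hz x hx => ?_⟩
  by_contra! hlt
  have hmem : (x : ℂ) ∈ Metric.ball ζ ε := by
    rw [Metric.mem_ball, dist_eq_norm]
    linarith [norm_sub_le_norm_sub_add_norm_sub (x : ℂ) z ζ]
  exact hball hmem ⟨x, hx, rfl⟩

theorem exists_apply_sub_smul_eq {A : E →L[ℂ] E} {z : ℂ} (hz : z ∉ spectrum ℂ A) (f : E) :
    ∃ x, A x - z • x = f := by
  obtain ⟨R, hR⟩ := (spectrum.notMem_iff.1 hz).exists_right_inv
  refine ⟨-R f, ?_⟩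
  have h1 : z • R f - A (R f) = f := DFunLike.congr_fun hR f
  rw [map_neg, smul_neg, sub_neg_eq_add, neg_add_eq_sub, h1]

theorem exists_chebyshev_approx [CompleteSpace E] {A : E →L[ℂ] E} (hA : IsSelfAdjoint A)
    {t₃ t₄ : ℝ} (ht : t₃ < t₄)
    (hs : spectrum ℂ A ⊆ Complex.ofReal '' Set.Icc t₃ t₄) {V : ℕ → Submodule ℂ E} {e : E}
    (hmono : Monotone V) (he : e ∈ V 1) (hV : ∀ n, ∀ x ∈ V n, A x ∈ V (n + 1))
    {z k : ℂ} {v : E} (hv : A v - z • v = k • e) (hz : z ∉ Complex.ofReal '' Set.Icc t₃ t₄) :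
    ∃ y : ℕ → E, (∀ n, y n ∈ V n) ∧
      (∀ n, (ellipseQ t₃ t₄ z ^ n - 1) / 2 * ‖v - y n‖ ≤ ‖v‖) ∧ Tendsto y atTop (𝓝 v) := by
  have h1 : ∀ n, ∃ y ∈ V n, ‖(chebyshevOn t₃ t₄ n).eval z‖ * ‖v - y‖ ≤ ‖v‖ := fun n =>
    exists_krylov_approx hmono he hV (natDegree_chebyshevOn_le t₃ t₄ n)
      (norm_aeval_le_of_spectrum_subset hA hs _ zero_le_one
        fun x hx => norm_eval_chebyshevOn_le ht n hx) hv
  choose y hyV hy using h1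
  have h2 : ∀ n, (ellipseQ t₃ t₄ z ^ n - 1) / 2 * ‖v - y n‖ ≤ ‖v‖ := fun n =>
    (mul_le_mul_of_nonneg_right (ellipseQ_pow_le_norm_eval_chebyshevOn ht z n)
      (norm_nonneg _)).trans (hy n)
  refine ⟨y, hyV, h2, tendsto_iff_norm_sub_tendsto_zero.2 ?_⟩
  have h3 : Tendsto (fun n => (ellipseQ t₃ t₄ z ^ n - 1) / 2) atTop atTop :=
    (tendsto_atTop_add_const_right _ (-1)
      (tendsto_pow_atTop_atTop_of_one_lt (one_lt_ellipseQ ht hz))).atTop_div_const two_pos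
  refine squeeze_zero' (Eventually.of_forall fun n => norm_nonneg _) ?_
    ((tendsto_const_nhds (x := ‖v‖)).div_atTop h3)
  filter_upwards [h3.eventually_gt_atTop 0] with n hn
  rw [le_div_iff₀ hn, mul_comm, norm_sub_rev]
  exact h2 n

theorem IsGalerkinEigenpair.limsup_le_and_eventually_real [CompleteSpace E] {A : E →L[ℂ] E}
    (hA : IsSelfAdjoint A)
    {t₃ t₄ : ℝ} (ht : t₃ < t₄) (hs : spectrum ℂ A ⊆ Complex.ofReal '' Set.Icc t₃ t₄)
    {V : ℕ → Submodule ℂ E} {e : E} (hmono : Monotone V) (he : e ∈ V 1) (he1 : ‖e‖ = 1)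
    (hV : ∀ n, ∀ x ∈ V n, A x ∈ V (n + 1)) {α β : ℝ} {z : ℕ → ℂ} {v : ℕ → E} {ζ : ℂ} {u : E}
    (h : ∀ n, IsGalerkinEigenpair A e α β (V n) (z n) (v n))
    (hu : IsGalerkinEigenpair A e α β ⊤ ζ u) (hζ : ζ ∉ Complex.ofReal '' Set.Icc t₃ t₄)
    (hsimple : ∀ u', A u' - conj ζ • u' = (-β : ℂ) • e → ⟪u', u⟫_ℂ ≠ 1) :
    limsup (fun n : ℕ => ((‖ζ - z n‖ ^ (1 / (n : ℝ)) : ℝ) : EReal)) atTop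
      ≤ ((1 / ellipseQ t₃ t₄ ζ ^ 2 : ℝ) : EReal) ∧
    (ζ.im = 0 → ∀ᶠ n in atTop, (z n).im = 0) := by
  have hsym := ContinuousLinearMap.isSelfAdjoint_iff_isSymmetric.1 hA
  have hζ' : conj ζ ∉ Complex.ofReal '' Set.Icc t₃ t₄ := by
    rintro ⟨x, hx, hxζ⟩
    exact hζ ⟨x, hx, by rw [← Complex.conj_ofReal, hxζ, Complex.conj_conj]⟩
  obtain ⟨u', hu'⟩ := exists_apply_sub_smul_eq (fun hmem => hζ' (hs hmem)) ((-β : ℂ) • e)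
  obtain ⟨y, hyV, hyq, hy⟩ := exists_chebyshev_approx hA ht hs hmono he hV hu.resolvent_eq hζ
  obtain ⟨w, hwV, hwq, hw⟩ := exists_chebyshev_approx hA ht hs hmono he hV hu' hζ'
  rw [ellipseQ_conj] at hwq
  obtain ⟨δ, hδ0, hδ⟩ := exists_pos_forall_le_norm_sub hζ
  have hz := tendsto_eigenvalue hsym he1 h hu hyV hy
  have hcoer : ∀ᶠ n in atTop, ∀ x, δ * ‖x‖ ^ 2 ≤ ‖⟪x, A x - z n • x⟫_ℂ‖ := by
    filter_upwards [hz.eventually (Metric.ball_mem_nhds ζ hδ0)] with n hn x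
    exact coercive_of_spectrum_subset hA ht hs (hδ (z n) (by simpa [dist_eq_norm] using hn)) x
  have hq := one_lt_ellipseQ ht hζ
  constructor
  · obtain ⟨K, hK0, hK⟩ := eventually_norm_sub_le_mul hsym he1 h hu hyV hy hδ0 hcoer hu'
      (hsimple u' hu') hwV hw
    refine limsup_rpow_le_of_mul_pow_le (fun n => norm_nonneg _) hq (C := K * (‖u'‖ * ‖u‖)) ?_
    filter_upwards [hK] with n hn
    set Q := (ellipseQ t₃ t₄ ζ ^ n - 1) / 2
    have hQ : 0 ≤ Q := div_nonneg (sub_nonneg.2 (one_le_pow₀ hq.le)) two_pos.le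
    calc ‖ζ - z n‖ * Q ^ 2 ≤ K * (‖u' - w n‖ * ‖u - y n‖) * Q ^ 2 := by gcongr
      _ = K * ((Q * ‖u' - w n‖) * (Q * ‖u - y n‖)) := by ring
      _ ≤ K * (‖u'‖ * ‖u‖) := by
        gcongr
        · exact hwq n
        · exact hyq n
  · intro hreal
    -- For real `ζ` the primal and dual equations coincide, so `u` itself may serve as `u'`.
    have hu1 : ‖u‖ ≠ 1 := fun h1 => by
      refine hsimple u ?_ ?_
      · rw [Complex.conj_eq_iff_im.2 hreal]; exact hu.resolvent_eq
      · rw [inner_self_eq_norm_sq_to_K, h1]; simp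
    have hv := (tendsto_eigenvector he1 h hu hyV hy hz hδ0 hcoer).norm
    filter_upwards [hv.eventually_ne hu1] with n hn
    by_contra hne
    exact hn ((h n).norm_eq_one_of_im_ne_zero hA hne)

end GalerkinRate

/-! ### Sequence spaces: self-adjointness, supports and the form `η`. -/

section EllTwoSequences

open scoped InnerProductSpace ComplexConjugate

theorem isSelfAdjoint_diagOp (c : ℕ → ℝ) (hc : ∃ C : ℝ, ∀ j, |c j| ≤ C) :
    IsSelfAdjoint (diagOp c hc) := by
  refine ContinuousLinearMap.isSelfAdjoint_iff_isSymmetric.2 fun x y => ?_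
  change ⟪diagOp c hc x, y⟫_ℂ = ⟪x, diagOp c hc y⟫_ℂ
  rw [lp.inner_eq_tsum, lp.inner_eq_tsum]
  refine tsum_congr fun j => ?_
  rw [diagOp_apply, diagOp_apply]
  simp only [RCLike.inner_apply, map_mul, Complex.conj_ofReal]
  ring

theorem isSelfAdjoint_tridiagonalOp (diag off : ℕ → ℝ) (hd : ∃ C : ℝ, ∀ j, |diag j| ≤ C)
    (ho : ∃ C : ℝ, ∀ j, |off j| ≤ C) : IsSelfAdjoint (tridiagonalOp diag off off hd ho ho) := by
  have h1 := isSelfAdjoint_diagOp diag hd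
  have h2 := isSelfAdjoint_diagOp off ho
  rw [ContinuousLinearMap.isSelfAdjoint_iff'] at *
  rw [tridiagonalOp, forwardShift, map_add, map_add, ContinuousLinearMap.adjoint_comp,
    ContinuousLinearMap.adjoint_comp, ContinuousLinearMap.adjoint_adjoint, h1, h2]
  abel

/-- The square-summable sequences supported on `{0, ..., n - 1}`. -/
def supportedBelow (n : ℕ) : Submodule ℂ EllTwo where
  carrier := {x | ∀ j, n ≤ j → x j = 0}
  add_mem' {x y} hx hy j hj := by
    change x j + y j = 0
    rw [hx j hj, hy j hj, add_zero]
  zero_mem' _ _ := rfl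
  smul_mem' c x hx j hj := by
    change c * x j = 0
    rw [hx j hj, mul_zero]

theorem supportedBelow_mono : Monotone supportedBelow :=
  fun _ _ h _ hx j hj => hx j (h.trans hj)

theorem tridiagonalOp_mem_supportedBelow (diag sup sub : ℕ → ℝ) (hd : ∃ C : ℝ, ∀ j, |diag j| ≤ C)
    (hp : ∃ C : ℝ, ∀ j, |sup j| ≤ C) (hb : ∃ C : ℝ, ∀ j, |sub j| ≤ C) {n : ℕ} {x : EllTwo}
    (hx : x ∈ supportedBelow n) : tridiagonalOp diag sup sub hd hp hb x ∈ supportedBelow (n + 1) := by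
  intro j hj
  obtain ⟨i, rfl⟩ : ∃ i, j = i + 1 := ⟨j - 1, by omega⟩
  rw [tridiagonalOp_apply_succ, hx i (by omega), hx (i + 1) (by omega), hx (i + 2) (by omega)]
  simp

/-- The first basis vector of `ℓ²`. -/
noncomputable def ellTwoE₀ : EllTwo := lp.single 2 0 (1 : ℂ)

theorem ellTwoE₀_zero : ellTwoE₀ 0 = 1 := lp.single_apply_self _ _ _

theorem ellTwoE₀_succ (j : ℕ) : ellTwoE₀ (j + 1) = 0 :=
  lp.single_apply_ne _ _ _ (Nat.succ_ne_zero j)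

theorem norm_ellTwoE₀ : ‖ellTwoE₀‖ = 1 := by
  rw [ellTwoE₀, lp.norm_single (by norm_num), norm_one]

theorem inner_ellTwoE₀_left (x : EllTwo) : ⟪ellTwoE₀, x⟫_ℂ = x 0 := by
  rw [ellTwoE₀, lp.inner_single_left]
  simp

theorem ellTwoE₀_mem : ellTwoE₀ ∈ supportedBelow 1 := by
  intro j hj
  obtain ⟨i, rfl⟩ : ∃ i, j = i + 1 := ⟨j - 1, by omega⟩
  exact ellTwoE₀_succ i

theorem norm_sq_eq_tsum (x : EllTwo) : ‖x‖ ^ 2 = ∑' j, ‖x j‖ ^ 2 := by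
  have h := lp.norm_rpow_eq_tsum (p := 2) (by norm_num) x
  simpa using h

theorem summable_norm_sq (x : EllTwo) : Summable fun j => ‖x j‖ ^ 2 := by
  have h := (lp.memℓp x).summable (by norm_num)
  simpa using h

theorem norm_sq_eq_add_backShift (x : EllTwo) : ‖x‖ ^ 2 = ‖x 0‖ ^ 2 + ‖backShift x‖ ^ 2 := by
  rw [norm_sq_eq_tsum, norm_sq_eq_tsum, (summable_norm_sq x).tsum_eq_zero_add]
  rfl

theorem re_inner_eta (x : EllTwo) :
    (⟪x, eta x⟫_ℂ).re = ‖backShift x‖ ^ 2 - ‖x 0‖ ^ 2 := by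
  have h1 : eta x = x - (2 * x 0) • ellTwoE₀ := by
    refine lp.ext (funext fun j => ?_)
    change (etaSign j : ℂ) * x j = x j - 2 * x 0 * ellTwoE₀ j
    rcases j with _ | j
    · rw [ellTwoE₀_zero]; simp [etaSign]; ring
    · rw [ellTwoE₀_succ]; simp [etaSign]
  have h2 : ⟪x, ellTwoE₀⟫_ℂ = conj (x 0) := by rw [← inner_conj_symm, inner_ellTwoE₀_left]
  have h3 : x 0 * conj (x 0) = ((‖x 0‖ ^ 2 : ℝ) : ℂ) := by
    rw [Complex.mul_conj, Complex.normSq_eq_norm_sq]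
  have h4 : ⟪x, x⟫_ℂ = ((‖x‖ ^ 2 : ℝ) : ℂ) := by
    rw [inner_self_eq_norm_sq_to_K]; push_cast; rfl
  have h5 : ⟪x, eta x⟫_ℂ = ((‖x‖ ^ 2 - 2 * ‖x 0‖ ^ 2 : ℝ) : ℂ) := by
    rw [h1, inner_sub_right, inner_smul_right, h2, mul_assoc, h3, h4]; push_cast; rfl
  rw [h5, Complex.ofReal_re, norm_sq_eq_add_backShift]
  ring

/-- Galerkin equations on `supportedBelow n` see only the coordinates below `n`; the entry of `H₁ v`
at `n`, which the truncation discards, plays no role. -/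
theorem inner_congr_of_mem_supportedBelow {n : ℕ} {w x y : EllTwo} (hw : w ∈ supportedBelow n)
    (h : ∀ j < n, x j = y j) : ⟪w, x⟫_ℂ = ⟪w, y⟫_ℂ := by
  rw [lp.inner_eq_tsum, lp.inner_eq_tsum]
  refine tsum_congr fun j => ?_
  rcases lt_or_ge j n with hj | hj
  · rw [h j hj]
  · rw [hw j hj, inner_zero_left, inner_zero_left]

end EllTwoSequences

/-! ### Jacobi matrices as Galerkin problems. -/

namespace JacobiParameters

variable (J : JacobiParameters)

open scoped InnerProductSpace ComplexConjugate

theorem isSelfAdjoint_H₁ : IsSelfAdjoint J.H₁ := isSelfAdjoint_tridiagonalOp _ _ _ _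

theorem H₁_mem_supportedBelow (n : ℕ) (x : EllTwo) (hx : x ∈ supportedBelow n) :
    J.H₁ x ∈ supportedBelow (n + 1) := tridiagonalOp_mem_supportedBelow _ _ _ _ _ _ hx

theorem H_apply_zero (x : EllTwo) : J.H x 0 = J.a 0 * x 0 - J.b 0 * x 1 := by
  rw [H, tridiagonalOp_apply_zero]
  simp [signedB, sub_eq_add_neg]

/-- The lower row of the block form of `H`; `H_apply_zero` is the upper row. -/
theorem backShift_H (x : EllTwo) :
    backShift (J.H x) = J.H₁ (backShift x) + (J.b 0 * x 0) • ellTwoE₀ := by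
  refine lp.ext (funext fun j => ?_)
  change J.H x (j + 1) = J.H₁ (backShift x) j + J.b 0 * x 0 * ellTwoE₀ j
  rw [H, tridiagonalOp_apply_succ, H₁]
  rcases j with _ | j
  · rw [tridiagonalOp_apply_zero, ellTwoE₀_zero]
    simp only [backShift_apply, signedB]
    simp
    ring
  · rw [tridiagonalOp_apply_succ, ellTwoE₀_succ]
    simp only [backShift_apply, signedB]
    simp

theorem ext_backShift {x y : EllTwo} (h0 : x 0 = y 0) (h : backShift x = backShift y) : x = y := by
  refine lp.ext (funext fun j => ?_)
  rcases j with _ | j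
  · exact h0
  · exact congrArg (fun t : EllTwo => t j) h

theorem backShift_forwardShift (x : EllTwo) : backShift (forwardShift x) = x :=
  lp.ext (funext fun j => forwardShift_apply_succ x j)

/-- An eigenvector of nonpositive type normalised to have first entry `1`. -/
theorem exists_isGalerkinEigenpair_top {z : ℂ} (h : IsNonposTypeEigenvalue eta J.H z) :
    ∃ f : EllTwo, f 0 = 1 ∧ J.H f = z • f ∧
      IsGalerkinEigenpair J.H₁ ellTwoE₀ (J.a 0) (J.b 0) ⊤ z (backShift f) := by
  obtain ⟨him, f, hf, hη⟩ := h
  have hHf : J.H f = z • f := hf.apply_eq_smul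
  rw [re_inner_eta] at hη
  -- If the first entry vanished, `⟨f, η f⟩ ≤ 0` would force the tail to vanish as well.
  have h0 : f 0 ≠ 0 := by
    intro h0
    rw [h0, norm_zero] at hη
    have h1 : ‖backShift f‖ = 0 := by nlinarith [norm_nonneg (backShift f)]
    exact hf.2 (ext_backShift h0 (by rw [norm_eq_zero.1 h1, map_zero]))
  refine ⟨(f 0)⁻¹ • f, inv_mul_cancel₀ h0, by rw [map_smul, hHf, smul_comm], trivial, ?_, ?_, ?_,
    him⟩
  · intro w _
    have h1 : J.H₁ (backShift f) - z • backShift f = (-(J.b 0 * f 0 : ℂ)) • ellTwoE₀ := by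
      rw [← map_smul backShift, ← hHf, backShift_H, neg_smul]; abel
    rw [map_smul, map_smul, smul_comm z, ← smul_sub, h1, smul_smul, inner_smul_right]
    field_simp
  · have h1 := congrArg (fun x : EllTwo => x 0) hHf
    change J.H f 0 = z * f 0 at h1
    rw [H_apply_zero] at h1
    rw [inner_ellTwoE₀_left, map_smul]
    change (J.b 0 : ℂ) * ((f 0)⁻¹ * f 1) = _
    field_simp
    linear_combination -h1
  · rw [map_smul, norm_smul, norm_inv, inv_mul_le_iff₀ (norm_pos_iff.2 h0), mul_one]
    exact (sq_le_sq₀ (norm_nonneg _) (norm_nonneg _)).1 (by linarith)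

/-- At a simple eigenvalue the eigenvector does not pair to zero with the dual eigenvector. -/
theorem inner_ne_one_of_isSimpleEigenvalue {z : ℂ} (hz : z ∉ spectrum ℂ J.H₁)
    (hs : IsSimpleEigenvalue J.H z) {f : EllTwo} (hf0 : f 0 = 1) (hf : J.H f = z • f) {u' : EllTwo}
    (hu' : J.H₁ u' - conj z • u' = (-J.b 0 : ℂ) • ellTwoE₀) : ⟪u', backShift f⟫_ℂ ≠ 1 := by
  intro h1
  obtain ⟨u, hu⟩ := exists_apply_sub_smul_eq hz (backShift f)
  have hsym : ⟪J.H₁ u', u⟫_ℂ = ⟪u', J.H₁ u⟫_ℂ :=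
    ContinuousLinearMap.isSelfAdjoint_iff_isSymmetric.1 J.isSelfAdjoint_H₁ u' u
  -- Moving `H₁ - z` across in `1 = ⟨u', (H₁ - z) u⟩` leaves `-b 0 ⟨e, u⟩`. This is also the first
  -- entry of `(H - z)(0, u)`, so `g = (0, u)` satisfies `(H - z) g = f`.
  have h2 : -(J.b 0 : ℂ) * u 0 = 1 := by
    have h3 : J.H₁ u' = conj z • u' + (-J.b 0 : ℂ) • ellTwoE₀ := by rw [← hu']; abel
    rw [← hu, inner_sub_right, ← hsym, h3, inner_add_left, inner_smul_left, inner_smul_left,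
      inner_smul_right, Complex.conj_conj, inner_ellTwoE₀_left, map_neg, Complex.conj_ofReal] at h1
    linear_combination h1
  set g : EllTwo := forwardShift u
  have hg0 : g 0 = 0 := forwardShift_apply_zero u
  have hg : J.H g - z • g = f := by
    refine ext_backShift ?_ ?_
    · change J.H g 0 - z * g 0 = f 0
      rw [H_apply_zero, hg0, forwardShift_apply_succ, hf0]
      linear_combination h2
    · rw [map_sub, map_smul, backShift_H, hg0, backShift_forwardShift, mul_zero, zero_smul,
        add_zero, hu]
  set T : Module.End ℂ EllTwo := (J.H : EllTwo →ₗ[ℂ] EllTwo)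
  have hTf : (T - algebraMap ℂ _ z) f = 0 := sub_eq_zero.2 hf
  have hTg : (T - algebraMap ℂ _ z) g = f := hg
  have hfmem : f ∈ T.maxGenEigenspace z :=
    (Module.End.mem_maxGenEigenspace T z f).2 ⟨1, by rw [pow_one]; exact hTf⟩
  have hgmem : g ∈ T.maxGenEigenspace z :=
    (Module.End.mem_maxGenEigenspace T z g).2 ⟨2, by
      rw [pow_two]
      change (T - algebraMap ℂ _ z) ((T - algebraMap ℂ _ z) g) = 0
      rw [hTg, hTf]⟩
  have hfne : (⟨f, hfmem⟩ : T.maxGenEigenspace z) ≠ 0 := fun h => by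
    have h3 := congrArg (fun x : T.maxGenEigenspace z => (x : EllTwo) 0) h
    change f 0 = 0 at h3
    rw [hf0] at h3
    exact one_ne_zero h3
  -- The chain `g ↦ f ↦ 0` would lie on one line, but `g 0 = 0` and `f 0 = 1` force `g = 0`, hence
  -- `f = 0`.
  obtain ⟨c, hc⟩ := (finrank_eq_one_iff_of_nonzero' _ hfne).1 hs ⟨g, hgmem⟩
  have hc' : c • f = g := congrArg Subtype.val hc
  have hc0 : c = 0 := by
    have h3 := congrArg (fun x : EllTwo => x 0) hc'
    change c * f 0 = g 0 at h3
    rwa [hf0, hg0, mul_one] at h3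
  have hfzero : f = 0 := by rw [← hTg, ← hc', hc0, zero_smul, map_zero]
  exact hfne (Subtype.ext hfzero)

/-- The zero extension of a vector in `ℂ^{n+1}`. -/
noncomputable def zeroExtend {n : ℕ} (f : EuclideanSpace ℂ (Fin (n + 1))) : ℕ → ℂ :=
  fun j => if h : j < n + 1 then f ⟨j, h⟩ else 0

theorem zeroExtend_apply {n : ℕ} (f : EuclideanSpace ℂ (Fin (n + 1))) (i : Fin (n + 1)) :
    zeroExtend f i = f i := dif_pos i.2

theorem zeroExtend_of_lt {n : ℕ} (f : EuclideanSpace ℂ (Fin (n + 1))) {j : ℕ} (hj : n < j) :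
    zeroExtend f j = 0 := dif_neg (by omega)

/-- Zero extension gives every row, including the last, the three-term form of the operator on `ℓ²`.
Row 0 is separated because `i - 1` truncates at 0. -/
theorem truncH_apply (n : ℕ) (f : EuclideanSpace ℂ (Fin (n + 1))) (i : Fin (n + 1)) :
    J.truncH n f i = J.a i * zeroExtend f i + J.signedB i * zeroExtend f (i + 1) +
      (if (i : ℕ) = 0 then 0 else J.b (i - 1) * zeroExtend f (i - 1)) := by
  have h1 : J.truncH n f i = ∑ k : Fin (n + 1), J.truncMatrix n i k * f k := rfl
  have h2 : ∀ k : Fin (n + 1), J.truncMatrix n i k * f k =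
      (if (i : ℕ) = k then J.a i * zeroExtend f k else 0) +
      (if (i : ℕ) + 1 = k then J.signedB i * zeroExtend f k else 0) +
      (if (i : ℕ) = k + 1 then J.b k * zeroExtend f k else 0) := by
    intro k
    rw [zeroExtend_apply, truncMatrix, Matrix.of_apply]
    split_ifs <;> first | omega | simp
  rw [h1, Finset.sum_congr rfl fun k _ => h2 k,
    Fin.sum_univ_eq_sum_range (fun k => (if (i : ℕ) = k then (J.a i : ℂ) * zeroExtend f k else 0) +
      (if (i : ℕ) + 1 = k then J.signedB i * zeroExtend f k else 0) +
      (if (i : ℕ) = k + 1 then J.b k * zeroExtend f k else 0)) (n + 1),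
    Finset.sum_add_distrib, Finset.sum_add_distrib, Finset.sum_ite_eq, Finset.sum_ite_eq,
    if_pos (Finset.mem_range.2 i.2)]
  congr 1
  · congr 1
    split_ifs with h
    · rfl
    · rw [zeroExtend_of_lt f (by simpa using h), mul_zero]
  · obtain ⟨i, hi⟩ := i
    rcases i with _ | i
    · simp
    · simp only [add_left_inj, Finset.sum_ite_eq, Nat.add_sub_cancel, Nat.succ_ne_zero, if_false]
      rw [if_pos (Finset.mem_range.2 (by omega))]

theorem re_inner_etaFin (n : ℕ) (f : EuclideanSpace ℂ (Fin (n + 1))) :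
    (⟪f, etaFin n f⟫_ℂ).re = ∑ i : Fin n, ‖f i.succ‖ ^ 2 - ‖f 0‖ ^ 2 := by
  have h1 : ∀ i, etaFin n f i = (etaSign i : ℂ) * f i := fun i => by
    change (Matrix.diagonal fun i : Fin (n + 1) => (etaSign i : ℂ)).mulVec f i = _
    rw [Matrix.mulVec_diagonal]
  have h2 : ∀ i, ⟪f i, etaFin n f i⟫_ℂ = ((etaSign i * ‖f i‖ ^ 2 : ℝ) : ℂ) := fun i => by
    rw [h1, RCLike.inner_apply, mul_assoc, Complex.mul_conj, Complex.normSq_eq_norm_sq]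
    push_cast; rfl
  rw [PiLp.inner_apply, Finset.sum_congr rfl fun i _ => h2 i, ← Complex.ofReal_sum,
    Complex.ofReal_re, Fin.sum_univ_succ]
  simp [etaSign]
  ring

/-- Row 0 of the matrix equation gives `root` and rows `1, ..., n` give the Galerkin equations. A
tail in `ℂ^{n+1}` has `n` entries, whence `supportedBelow n`. -/
theorem exists_isGalerkinEigenpair {n : ℕ} {z : ℂ}
    (h : IsNonposTypeEigenvalue (etaFin n) (J.truncH n) z) :
    ∃ v, IsGalerkinEigenpair J.H₁ ellTwoE₀ (J.a 0) (J.b 0) (supportedBelow n) z v := by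
  obtain ⟨him, f, hf, hη⟩ := h
  have hHf : J.truncH n f = z • f := hf.apply_eq_smul
  rw [re_inner_etaFin] at hη
  have h0 : f 0 ≠ 0 := by
    intro h0
    rw [h0, norm_zero] at hη
    have h1 : ∑ i : Fin n, ‖f i.succ‖ ^ 2 = 0 :=
      le_antisymm (by linarith) (Finset.sum_nonneg fun i _ => by positivity)
    rw [Finset.sum_eq_zero_iff_of_nonneg fun i _ => by positivity] at h1
    refine hf.2 (PiLp.ext fun i => ?_)
    refine Fin.cases h0 (fun i => ?_) i
    exact norm_eq_zero.1 (pow_eq_zero_iff two_ne_zero |>.1 (h1 i (Finset.mem_univ _)))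
  set g := zeroExtend f
  have hgi : ∀ i : Fin (n + 1), g i = f i := zeroExtend_apply f
  have hgn : ∀ j, n < j → g j = 0 := fun _ => zeroExtend_of_lt f
  have hg0 : g 0 = f 0 := hgi 0
  have heq : ∀ i : Fin (n + 1), J.a i * g i + J.signedB i * g (i + 1) +
      (if (i : ℕ) = 0 then 0 else J.b (i - 1) * g (i - 1)) = z * g i := fun i => by
    rw [← J.truncH_apply n f i, hHf, hgi]; rfl
  have hmem : Memℓp (fun j => (f 0)⁻¹ * g (j + 1)) 2 := by
    refine memℓp_gen (summable_of_ne_finset_zero (s := Finset.range n) fun j hj => ?_)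
    rw [hgn _ (Nat.lt_succ_of_le (by simpa using hj))]
    simp
  set v : EllTwo := ⟨fun j => (f 0)⁻¹ * g (j + 1), hmem⟩
  have hv : ∀ j, v j = (f 0)⁻¹ * g (j + 1) := fun _ => rfl
  refine ⟨v, ?_, ?_, ?_, ?_, him⟩
  · intro j hj
    rw [hv, hgn _ (by omega), mul_zero]
  · intro w hw
    rw [← inner_smul_right]
    refine inner_congr_of_mem_supportedBelow hw fun j hj => ?_
    have h1 := heq ⟨j + 1, by omega⟩
    change J.H₁ v j - z * v j = -J.b 0 * ellTwoE₀ j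
    simp only [signedB, Nat.succ_ne_zero, if_false, Nat.add_sub_cancel] at h1
    rw [H₁]
    rcases j with _ | j
    · rw [tridiagonalOp_apply_zero, ellTwoE₀_zero, hv, hv]
      rw [zero_add, hg0] at h1
      field_simp
      linear_combination h1
    · rw [tridiagonalOp_apply_succ, ellTwoE₀_succ, hv, hv, hv]
      field_simp
      linear_combination h1
  · have h1 := heq 0
    simp only [Fin.val_zero, signedB, if_true, hg0] at h1
    rw [inner_ellTwoE₀_left, hv]
    field_simp
    push_cast at h1
    linear_combination -h1
  · have h1 : ‖v‖ ^ 2 = (‖f 0‖ ^ 2)⁻¹ * ∑ i : Fin n, ‖f i.succ‖ ^ 2 := by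
      rw [norm_sq_eq_tsum, tsum_eq_sum (s := Finset.range n), ← Fin.sum_univ_eq_sum_range
        (fun j => ‖v j‖ ^ 2), Finset.mul_sum]
      · refine Finset.sum_congr rfl fun i _ => ?_
        rw [hv, norm_mul, norm_inv, mul_pow, inv_pow, ← hgi i.succ, Fin.val_succ]
      · intro j hj
        rw [hv, hgn _ (Nat.lt_succ_of_le (by simpa using hj))]
        simp
    refine (sq_le_one_iff₀ (norm_nonneg _)).1 ?_
    rw [h1, inv_mul_le_iff₀ (by positivity), mul_one]
    linarith

end JacobiParameters

theorem theorem3p3 (J : JacobiParameters) (t₃ t₄ : ℝ) (ht : t₃ < t₄)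
    (hspec : spectrum ℂ J.H₁ ⊆ Complex.ofReal '' Set.Icc t₃ t₄)
    (lamInf : ℂ) (hInf : IsNonposTypeEigenvalue eta J.H lamInf)
    (lam : ℕ → ℂ) (hlam : ∀ n, IsNonposTypeEigenvalue (etaFin n) (J.truncH n) (lam n))
    (hout : lamInf ∉ Complex.ofReal '' Set.Icc t₃ t₄)
    (hsimple : IsSimpleEigenvalue J.H lamInf) :
    1 < ellipseG t₃ t₄ lamInf ∧
    limsup (fun n : ℕ => ((‖lamInf - lam n‖ ^ (1 / (n : ℝ)) : ℝ) : EReal)) atTop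
      ≤ ((1 / ellipseQ t₃ t₄ lamInf ^ 2 : ℝ) : EReal) ∧
    (lamInf.im = 0 → ∀ᶠ n in atTop, (lam n).im = 0) := by
  obtain ⟨f, hf0, hf, hu⟩ := J.exists_isGalerkinEigenpair_top hInf
  choose v hv using fun n => J.exists_isGalerkinEigenpair (hlam n)
  exact ⟨one_lt_ellipseG ht hout, IsGalerkinEigenpair.limsup_le_and_eventually_real
    J.isSelfAdjoint_H₁ ht hspec supportedBelow_mono ellTwoE₀_mem norm_ellTwoE₀
    J.H₁_mem_supportedBelow hv hu hout fun _ hu' =>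
      J.inner_ne_one_of_isSimpleEigenvalue (fun h => hout (hspec h)) hsimple hf0 hf hu'⟩
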